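/- Let $\mathbb X$ be a locally compact separable metric space with its Borel $\sigma$-algebra. Let $\Omega$ be the set of configurations on $\mathbb X$, i.e. of locally finite subsets $\omega\subset\mathbb X$ (those having finitely many points in every compact set); $\omega$ is also regarded as the measure $\sum_{y\in\omega}\delta_y$. Equip $\Omega$ with the smallest $\sigma$-algebra making all maps $\omega\mapsto\omega(A)$, $A\subset\mathbb X$ Borel, measurable. Let $\sigma$ be a $\sigma$-finite non-atomic Borel measure on $\mathbb X$, and let $\mathbb P$, with expectation $\mathbb E$, be a probability measure on $\Omega$ under which $(A,\omega)\mapsto\omega(A)$ is a Poisson random measure with intensity $\sigma$: $\omega(A)$ has the Poisson distribution with mean $\sigma(A)$ for every Borel $A$ with $\sigma(A)<\infty$, and $\omega(A_1),\dots,\omega(A_m)$ are independent for pairwise disjoint Borel sets $A_1,\dots,A_m$. Put $\omega_1=\omega$ and $\omega_0=\sigma$. For a partition $P=\{P_1,\dots,P_k\}$ of $\{1,\dots,n\}$ into nonempty blocks and $y=(y_1,\dots,y_k)\in\mathbb X^k$, let $y^{[P]}\in\mathbb X^n$ be given by $y^{[P]}_i=y_j$ if $i\in P_j$. For $\epsilon=(\epsilon_1,\dots,\epsilon_n)\in\{0,1\}^n$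 let $\mathcal P_n^{\epsilon}$ be the set of all partitions $P$ of $\{1,\dots,n\}$ such that for every block $P_i$ with $|P_i|>1$ we have $\epsilon_j=1$ for all $j\in P_i$. For $P\in\mathcal P_n^\epsilon$ let $\epsilon^{[P]}_j$ be the common value of $\epsilon$ on the block $P_j$, and let $y_{\epsilon^{[P]}}=\{y_j:\epsilon^{[P]}_j=1\}$. Let $\mathbb X^k_{\neq}$ be the set of $y\in\mathbb X^k$ with pairwise distinct coordinates. Theorem. For every integer $n\ge 0$, every jointly measurable $f:\mathbb X^n\times\Omega\to[0,\infty]$ (in particular every nonnegative $n$-process) and every $\epsilon\in\{0,1\}^n$, $$\mathbb E\int_{\mathbb X^n} f(x;\omega)\,\omega_{\epsilon_1}(dx_1)\cdots\omega_{\epsilon_n}(dx_n)=\sum_{P=\{P_1,\dots,P_k\}\in\mathcal P_n^{\epsilon}}\ \int_{\mathbb X^k_{\neq}}\mathbb E\, f\big(y^{[P]};\,\omega\cup y_{\epsilon^{[P]}}\big)\,\sigma^k(dy),$$ as an identity in $[0,\infty]$. -/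

import Mathlib

open MeasureTheory ProbabilityTheory
open scoped ENNReal

/-- A configuration on `X`: a locally finite subset of `X`, i.e. a subset having finitely many
points in every compact set. -/
structure Configuration (X : Type*) [TopologicalSpace X] where
  carrier : Set X
  locallyFinite : ∀ K : Set X, IsCompact K → (carrier ∩ K).Finite

namespace Configuration

/-- The configuration `ω` regarded as the measure `∑_{y ∈ ω} δ_y`. -/
noncomputable def toMeasure {X : Type*} [TopologicalSpace X] [MeasurableSpace X]
    (ω : Configuration X) : Measure X :=
  Measure.sum fun y : ω.carrier => Measure.dirac (y : X)

/-- The smallest σ-algebra on the configuration space for which all the counting maps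
`ω ↦ ω(A)`, `A` Borel, are measurable. -/
noncomputable instance {X : Type*} [TopologicalSpace X] [MeasurableSpace X] :
    MeasurableSpace (Configuration X) :=
  ⨆ (A : Set X) (_ : MeasurableSet A),
    MeasurableSpace.comap (fun ω : Configuration X => ω.toMeasure A) inferInstance

/-- The configuration `ω ∪ s` obtained by adding a finite set of points. -/
def unionFinite {X : Type*} [TopologicalSpace X] (ω : Configuration X) (s : Set X)
    (hs : s.Finite) : Configuration X where
  carrier := ω.carrier ∪ s
  locallyFinite K hK := by
    rw [Set.union_inter_distrib_right]
    exact (ω.locallyFinite K hK).union (hs.inter_of_left K)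

end Configuration

/-- `Pr` is the law on the configuration space of a Poisson random measure with intensity `σ`:
the number of points in a Borel set `A` with `σ(A) < ∞` is Poisson distributed with mean `σ(A)`,
and the numbers of points in finitely many pairwise disjoint Borel sets are independent. -/
structure IsPoissonLaw {X : Type*} [TopologicalSpace X] [MeasurableSpace X]
    (σ : Measure X) (Pr : Measure (Configuration X)) : Prop where
  isProbabilityMeasure : IsProbabilityMeasure Pr
  map_count : ∀ A : Set X, MeasurableSet A → σ A ≠ ∞ →
    Pr.map (fun ω => ω.toMeasure A) =
      (poissonMeasure (σ A).toNNReal).map (fun k : ℕ => (k : ℝ≥0∞))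
  indep_count : ∀ (m : ℕ) (A : Fin m → Set X), (∀ i, MeasurableSet (A i)) →
    Pairwise (Function.onFun Disjoint A) →
    iIndepFun (fun i (ω : Configuration X) => ω.toMeasure (A i)) Pr

/-- `ω₁ = ω` and `ω₀ = σ`. -/
noncomputable def mixedMeasure {X : Type*} [TopologicalSpace X] [MeasurableSpace X]
    (σ : Measure X) (ω : Configuration X) (e : Fin 2) : Measure X :=
  if e = 1 then ω.toMeasure else σ

/-- The off-diagonal set: families `(y_i)` with pairwise distinct entries. -/
def offDiagonal (ι X : Type*) : Set (ι → X) :=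
  {y | ∀ i j, i ≠ j → y i ≠ y j}

/-- The partitions `P` of the index set such that `ε = 1` on every block of `P` having more than
one element. -/
def admissiblePartitions {n : ℕ} (ε : Fin n → Fin 2) :
    Finset (Finpartition (Finset.univ : Finset (Fin n))) :=
  Finset.univ.filter fun P => ∀ B ∈ P.parts, 1 < B.card → ∀ j ∈ B, ε j = 1

namespace Finpartition

/-- The block of `P` containing `i`. -/
def blockOf {n : ℕ} (P : Finpartition (Finset.univ : Finset (Fin n))) (i : Fin n) :
    {B // B ∈ P.parts} :=
  ⟨P.part i, P.part_mem.2 (Finset.mem_univ i)⟩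

/-- The vector `y^{[P]}`, where the entries of `y` are labelled by the blocks of `P`: its `i`-th
coordinate is `y_B` for the block `B` containing `i`. -/
def expand {n : ℕ} {X : Type*} (P : Finpartition (Finset.univ : Finset (Fin n)))
    (y : {B // B ∈ P.parts} → X) : Fin n → X :=
  fun i => y (P.blockOf i)

/-- `ε^{[P]}`: the value of `ε` at an element of the block (the least one, say). -/
def blockSign {n : ℕ} (P : Finpartition (Finset.univ : Finset (Fin n))) (ε : Fin n → Fin 2)
    (B : {B // B ∈ P.parts}) : Fin 2 :=
  ε (B.1.min' (P.nonempty_of_mem_parts B.2))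

/-- For admissible `P` the choice of the element of the block is immaterial. -/
theorem blockSign_eq {n : ℕ} (P : Finpartition (Finset.univ : Finset (Fin n)))
    (ε : Fin n → Fin 2) (hP : P ∈ admissiblePartitions ε) (B : {B // B ∈ P.parts})
    (i : Fin n) (hi : i ∈ B.1) : P.blockSign ε B = ε i := by
  have hm := B.1.min'_mem (P.nonempty_of_mem_parts B.2)
  rcases Nat.lt_or_ge 1 B.1.card with h | h
  · have hP' := (Finset.mem_filter.1 hP).2 B.1 B.2 h
    rw [blockSign, hP' _ hm, hP' _ hi]
  · rw [blockSign, Finset.card_le_one.1 h _ hm _ hi]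

/-- `y_{ε^{[P]}} = {y_B : ε^{[P]}_B = 1}`. -/
def markedPoints {n : ℕ} {X : Type*} (P : Finpartition (Finset.univ : Finset (Fin n)))
    (ε : Fin n → Fin 2) (y : {B // B ∈ P.parts} → X) : Set X :=
  y '' {B | P.blockSign ε B = 1}

theorem markedPoints_finite {n : ℕ} {X : Type*}
    (P : Finpartition (Finset.univ : Finset (Fin n)))
    (ε : Fin n → Fin 2) (y : {B // B ∈ P.parts} → X) : (P.markedPoints ε y).Finite :=
  (Set.toFinite _).image y

end Finpartition

/-!
The identity combines two facts, one deterministic and one about the Poisson law.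

*Coincidence patterns.* The product `X^n` is the disjoint union of the strata
`Finpartition.stratum P` of the vectors whose coordinates coincide exactly within the blocks of
`P`. Fix `ω`. A coordinate carrying `σ` differs almost everywhere from every other one, since `σ`
has no atoms; so the stratum of `P` is null unless `P` is admissible
(`Finpartition.pi_mixedMeasure_stratum_of_notMem`). On a block of several indices of an admissible
`P`, the measure is a power of `ω`, and `ω ⊗ ⋯ ⊗ ω` gives mass one to every diagonal point `(x, …, x)`,
`x ∈ ω`: on the diagonal it is the image of `ω` (`Configuration.restrict_pi_toMeasure`). Hence the
integral over the stratum of `P` is an off-diagonal integral with one variable per block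
(`lintegral_pi_mixedMeasure_eq_sum`).

*Mecke's formula.* For a single variable, `E ∫ f(x, ω) ω(dx) = ∫ E f(x, ω ∪ {x}) σ(dx)`
(`IsPoissonLaw.lintegral_lintegral_toMeasure`). By a π-system argument it suffices to take for
`f(x, ω)` the indicator of `x ∈ A` times a function of the numbers of points in finitely many sets
of finite measure. Cutting these sets into disjoint cells makes the numbers of points independent
Poisson variables, and the formula becomes the Chen–Stein identity `E[N h(N)] = r E[h(N + 1)]`.
The off-diagonal integrals are then treated by induction on the number of variables
(`IsPoissonLaw.lintegral_offDiagonal`): integrating `x` against `ω` adds `x` to `ω`, and this does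
not affect the integrations against `ω` over the remaining variables, which avoid `x`.
-/

universe u

/-! ### Configurations as measures -/

namespace Configuration

variable {X : Type*} [TopologicalSpace X] [MeasurableSpace X]

theorem measurable_toMeasure_apply {A : Set X} (hA : MeasurableSet A) :
    Measurable fun ω : Configuration X => ω.toMeasure A := by
  refine Measurable.of_comap_le ?_
  exact le_iSup₂_of_le (f := fun (A : Set X) (_ : MeasurableSet A) =>
    MeasurableSpace.comap (fun ω : Configuration X => ω.toMeasure A) inferInstance) A hA le_rfl

theorem measurable_of_measurable_toMeasure_apply {Z : Type*} [MeasurableSpace Z]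
    {g : Z → Configuration X}
    (hg : ∀ A : Set X, MeasurableSet A → Measurable fun z => (g z).toMeasure A) :
    Measurable g := by
  refine Measurable.of_le_map (iSup₂_le fun A hA => ?_)
  rw [MeasurableSpace.comap_le_iff_le_map]
  exact (hg A hA)

/-- The kernel `ω ↦ ∑_{y ∈ ω} δ_y`. -/
noncomputable def toKernel (X : Type*) [TopologicalSpace X] [MeasurableSpace X] :
    Kernel (Configuration X) X where
  toFun := toMeasure
  measurable' := Measure.measurable_of_measurable_coe _ fun _ hA => measurable_toMeasure_apply hA

@[simp]
theorem toKernel_apply (ω : Configuration X) : toKernel X ω = ω.toMeasure := rfl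

theorem countable_carrier {X : Type*} [TopologicalSpace X] [SigmaCompactSpace X]
    (ω : Configuration X) : ω.carrier.Countable := by
  rw [← Set.inter_univ ω.carrier, ← iUnion_compactCovering X, Set.inter_iUnion]
  exact Set.countable_iUnion fun n =>
    (ω.locallyFinite _ (isCompact_compactCovering X n)).countable

variable [T2Space X] [SecondCountableTopology X] [SigmaCompactSpace X] [BorelSpace X]

theorem measurableSet_carrier (ω : Configuration X) : MeasurableSet ω.carrier :=
  ω.countable_carrier.measurableSet

theorem toMeasure_eq_count_restrict (ω : Configuration X) :
    ω.toMeasure = Measure.count.restrict ω.carrier := by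
  ext A hA
  rw [toMeasure, Measure.sum_apply _ hA, Measure.restrict_apply hA,
    Measure.count_apply (hA.inter ω.measurableSet_carrier)]
  simp_rw [Measure.dirac_apply' _ hA]
  rw [tsum_subtype ω.carrier (fun y => A.indicator (1 : X → ℝ≥0∞) y), Set.indicator_indicator,
    Set.inter_comm, ← tsum_subtype]
  simp [ENNReal.tsum_one]

theorem toMeasure_lt_top (ω : Configuration X) {K : Set X} (hK : IsCompact K) :
    ω.toMeasure K < ∞ := by
  rw [toMeasure_eq_count_restrict, Measure.restrict_apply hK.measurableSet, Set.inter_comm]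
  exact Measure.count_apply_lt_top.2 (ω.locallyFinite K hK)

instance (ω : Configuration X) : IsFiniteMeasureOnCompacts ω.toMeasure :=
  ⟨fun _ hK => ω.toMeasure_lt_top hK⟩

instance sigmaFinite_toMeasure (ω : Configuration X) : SigmaFinite ω.toMeasure :=
  inferInstance

theorem toMeasure_singleton {ω : Configuration X} {x : X} (hx : x ∈ ω.carrier) :
    ω.toMeasure {x} = 1 := by
  rw [toMeasure_eq_count_restrict, Measure.restrict_apply (measurableSet_singleton x),
    Set.inter_eq_left.2 (by simpa using hx), Measure.count_singleton]

theorem toMeasure_compl_carrier (ω : Configuration X) : ω.toMeasure ω.carrierᶜ = 0 := by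
  rw [toMeasure_eq_count_restrict, Measure.restrict_apply ω.measurableSet_carrier.compl,
    Set.compl_inter_self, measure_empty]

/-- The configuration `ω ∪ {x}`. -/
def addPoint (ω : Configuration X) (x : X) : Configuration X :=
  ω.unionFinite {x} (Set.finite_singleton x)

/-- Away from `x`, the configurations `ω ∪ {x}` and `ω` are the same measure; no assumption
`x ∉ ω` is needed. -/
theorem restrict_toMeasure_addPoint (ω : Configuration X) (x : X) :
    (ω.addPoint x).toMeasure.restrict {x}ᶜ = ω.toMeasure.restrict {x}ᶜ := by
  rw [toMeasure_eq_count_restrict, toMeasure_eq_count_restrict,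
    Measure.restrict_restrict (measurableSet_singleton x).compl,
    Measure.restrict_restrict (measurableSet_singleton x).compl]
  congr 1
  ext y
  simp only [addPoint, unionFinite, Set.mem_inter_iff, Set.mem_compl_iff, Set.mem_union]
  tauto

theorem toMeasure_addPoint_apply (ω : Configuration X) (x : X) {A : Set X}
    (hA : MeasurableSet A) :
    (ω.addPoint x).toMeasure A = ω.toMeasure (A \ {x}) + A.indicator 1 x := by
  have hx := measurableSet_singleton x
  rw [← measure_inter_add_sdiff A hx, add_comm]
  have h1 : (ω.addPoint x).toMeasure (A \ {x}) = ω.toMeasure (A \ {x}) := by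
    have := congrArg (fun μ => μ A) (restrict_toMeasure_addPoint ω x)
    simpa [Measure.restrict_apply hA, Set.sdiff_eq] using this
  rw [h1]
  congr 1
  by_cases h : x ∈ A
  · rw [Set.inter_eq_right.2 (by simpa using h), toMeasure_singleton (Or.inr rfl)]
    simp [h]
  · have : A ∩ {x} = ∅ := by simpa using h
    simp [this, h]

theorem toMeasure_addPoint_apply_of_null {ω : Configuration X} {x : X}
    (h : ω.toMeasure {x} = 0) {A : Set X} (hA : MeasurableSet A) :
    (ω.addPoint x).toMeasure A = ω.toMeasure A + A.indicator 1 x := by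
  rw [toMeasure_addPoint_apply ω x hA, measure_sdiff_null h]

end Configuration

namespace ProbabilityTheory.Kernel

/-- A kernel whose value at every point is a finite measure is s-finite: the parameter
space is cut according to the integer part of the total mass. -/
theorem isSFiniteKernel_of_forall_isFiniteMeasure {α β : Type*} [MeasurableSpace α]
    [MeasurableSpace β] (κ : Kernel α β) (h : ∀ a, κ a Set.univ < ∞) : IsSFiniteKernel κ := by
  classical
  let N : α → ℕ := fun a => ⌊(κ a Set.univ).toNNReal⌋₊
  have hN : Measurable N :=
    Nat.measurable_floor.comp (κ.measurable_coe MeasurableSet.univ).ennreal_toNNReal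
  have hs : ∀ m, MeasurableSet (N ⁻¹' {m}) := fun m => hN (measurableSet_singleton m)
  have hκ : κ = Kernel.sum fun m => Kernel.piecewise (hs m) κ 0 := by
    ext a s hs'
    rw [Kernel.sum_apply' _ _ hs', tsum_eq_single (N a)]
    · simp [Kernel.piecewise_apply]
    · intro m hm
      rw [Kernel.piecewise_apply, if_neg (by simpa using hm.symm)]
      simp
  rw [hκ]
  refine Kernel.isSFiniteKernel_sum (hκs := fun m => ?_)
  have : IsFiniteKernel (Kernel.piecewise (hs m) κ 0) := by
    refine ⟨⟨(m : ℝ≥0∞) + 1, by finiteness, fun a => ?_⟩⟩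
    rw [Kernel.piecewise_apply]
    split_ifs with ha
    · have h1 : N a = m := ha
      have h2 := (Nat.lt_floor_add_one (κ a Set.univ).toNNReal).le
      rw [show ⌊(κ a Set.univ).toNNReal⌋₊ = m from h1] at h2
      rw [← ENNReal.coe_toNNReal (h a).ne]
      exact_mod_cast h2
    · simp
  infer_instance

end ProbabilityTheory.Kernel

namespace Configuration

variable {X : Type*} [TopologicalSpace X] [MeasurableSpace X]
  [T2Space X] [SecondCountableTopology X] [SigmaCompactSpace X] [BorelSpace X]

instance isSFiniteKernel_toKernel : IsSFiniteKernel (toKernel X) := by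
  have hm : ∀ n, MeasurableSet (disjointed (compactCovering X) n) := fun n =>
    MeasurableSet.disjointed (fun n => (isCompact_compactCovering X n).measurableSet) n
  have h : toKernel X = Kernel.sum fun n => (toKernel X).restrict (hm n) := by
    ext ω s hs
    rw [Kernel.sum_apply' _ _ hs]
    simp_rw [Kernel.restrict_apply]
    rw [← Measure.sum_apply _ hs, ← Measure.restrict_iUnion (disjoint_disjointed _) hm,
      iUnion_disjointed, iUnion_compactCovering, Measure.restrict_univ]
  rw [h]
  refine Kernel.isSFiniteKernel_sum (hκs := fun n => ?_)
  refine Kernel.isSFiniteKernel_of_forall_isFiniteMeasure _ fun ω => ?_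
  rw [Kernel.restrict_apply, Measure.restrict_apply_univ]
  exact (measure_mono (disjointed_subset _ _)).trans_lt
    (ω.toMeasure_lt_top (isCompact_compactCovering X n))

theorem measurable_addPoint :
    Measurable fun p : Configuration X × X => p.1.addPoint p.2 := by
  refine measurable_of_measurable_toMeasure_apply fun A hA => ?_
  simp_rw [toMeasure_addPoint_apply _ _ hA]
  refine Measurable.add ?_ ((measurable_one.indicator hA).comp measurable_snd)
  have hs : MeasurableSet {q : (Configuration X × X) × X | q.2 ∈ A ∧ q.2 ≠ q.1.2} := by
    refine (hA.preimage measurable_snd).inter (MeasurableSet.compl ?_)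
    exact measurableSet_eq_fun measurable_snd (measurable_snd.comp measurable_fst)
  have := Kernel.measurable_kernel_prodMk_left
    (κ := (toKernel X).comap (Prod.fst : Configuration X × X → _) measurable_fst) hs
  simpa using! this

end Configuration

/-! ### Mecke's formula for numbers of points -/

/-- The Chen–Stein identity `E[N h(N)] = r E[h(N + 1)]` of a Poisson variable `N` of mean `r`. -/
theorem lintegral_mul_poissonMeasure (r : NNReal) {h : ℝ≥0∞ → ℝ≥0∞} (hh : Measurable h) :
    ∫⁻ t, t * h t ∂((poissonMeasure r).map (fun k : ℕ => (k : ℝ≥0∞))) =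
      r * ∫⁻ t, h (t + 1) ∂((poissonMeasure r).map (fun k : ℕ => (k : ℝ≥0∞))) := by
  rw [lintegral_map (f := fun t => t * h t) (measurable_id.mul hh) (by fun_prop),
    lintegral_map (f := fun t => h (t + 1)) (hh.comp (by fun_prop)) (by fun_prop),
    poissonMeasure, lintegral_sum_measure, lintegral_sum_measure, ← ENNReal.tsum_mul_left]
  simp only [lintegral_smul_measure, lintegral_dirac, smul_eq_mul]
  rw [tsum_eq_zero_add' ENNReal.summable]
  simp only [Nat.cast_zero, zero_mul, mul_zero, zero_add]
  refine tsum_congr fun n => ?_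
  -- the Poisson weights satisfy `w (n + 1) * (n + 1) = r * w n`
  have hw : ENNReal.ofReal (Real.exp (-r) * r ^ (n + 1) / ((n + 1).factorial : ℝ)) *
      ((n + 1 : ℕ) : ℝ≥0∞) = r * ENNReal.ofReal (Real.exp (-r) * r ^ n / (n.factorial : ℝ)) := by
    rw [← ENNReal.ofReal_natCast, ← ENNReal.ofReal_coe_nnreal, ← ENNReal.ofReal_mul (by positivity),
      ← ENNReal.ofReal_mul (by positivity)]
    congr 1
    rw [Nat.factorial_succ]
    push_cast
    field_simp
    ring
  rw [← mul_assoc, hw, mul_assoc]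
  push_cast
  rfl

/-- The Chen–Stein identity in one coordinate of a vector of independent Poisson variables. -/
theorem lintegral_mul_pi_poissonMeasure {J : Type*} [Fintype J] [DecidableEq J] (r : J → NNReal)
    (j : J) {F : (J → ℝ≥0∞) → ℝ≥0∞} (hF : Measurable F) :
    ∫⁻ z, z j * F z ∂(Measure.pi fun i => (poissonMeasure (r i)).map (fun k : ℕ => (k : ℝ≥0∞))) =
      r j * ∫⁻ z, F (Function.update z j (z j + 1))
        ∂(Measure.pi fun i => (poissonMeasure (r i)).map (fun k : ℕ => (k : ℝ≥0∞))) := by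
  have hm : Measurable fun z : J → ℝ≥0∞ => F (Function.update z j (z j + 1)) := by
    refine hF.comp (measurable_pi_lambda _ fun i => ?_)
    by_cases h : i = j
    · subst h; simpa using (measurable_pi_apply i).add_const 1
    · simpa [h] using measurable_pi_apply i
  rw [← lintegral_const_mul _ hm]
  refine lintegral_eq_of_lmarginal_eq {j} ((measurable_pi_apply j).mul hF) (hm.const_mul _) ?_
  funext z
  rw [lmarginal_singleton, lmarginal_singleton]
  simp only [Function.update_self, Function.update_idem]
  have hz : Measurable fun t => F (Function.update z j t) := hF.comp (measurable_update z)
  rw [lintegral_mul_poissonMeasure (r j) hz, lintegral_const_mul]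
  exact hz.comp (measurable_id.add_const 1)

namespace IsPoissonLaw

variable {X : Type*} [TopologicalSpace X] [MeasurableSpace X] {σ : Measure X}
  {Pr : Measure (Configuration X)}

theorem iIndepFun_count (hPr : IsPoissonLaw σ Pr) {J : Type*} [Fintype J] {C : J → Set X}
    (hC : ∀ j, MeasurableSet (C j)) (hd : Pairwise (Function.onFun Disjoint C)) :
    iIndepFun (fun j (ω : Configuration X) => ω.toMeasure (C j)) Pr := by
  have e := Fintype.equivFin J
  have h := hPr.indep_count _ (fun i => C (e.symm i)) (fun i => hC _)
    (fun i k hik => hd (e.symm.injective.ne hik))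
  have := h.precomp (g := e) e.injective
  simpa using! this

theorem map_counts (hPr : IsPoissonLaw σ Pr) {J : Type*} [Fintype J] {C : J → Set X}
    (hC : ∀ j, MeasurableSet (C j)) (hd : Pairwise (Function.onFun Disjoint C))
    (hfin : ∀ j, σ (C j) ≠ ∞) :
    Pr.map (fun ω j => ω.toMeasure (C j)) =
      Measure.pi fun j => (poissonMeasure (σ (C j)).toNNReal).map (fun k : ℕ => (k : ℝ≥0∞)) := by
  rw [(hPr.iIndepFun_count hC hd).map_fun_eq_pi_map
    fun j => (Configuration.measurable_toMeasure_apply (hC j)).aemeasurable]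
  congr 1
  funext j
  exact hPr.map_count _ (hC j) (hfin j)

theorem lintegral_count (hPr : IsPoissonLaw σ Pr) {A : Set X} (hA : MeasurableSet A)
    (hfin : σ A ≠ ∞) : ∫⁻ ω, ω.toMeasure A ∂Pr = σ A := by
  rw [← lintegral_map (f := fun t => t) measurable_id
    (Configuration.measurable_toMeasure_apply hA), hPr.map_count A hA hfin]
  have := lintegral_mul_poissonMeasure (σ A).toNNReal (h := fun _ => 1) measurable_const
  simpa [ENNReal.coe_toNNReal hfin] using this

variable [T2Space X] [BorelSpace X] [NullSingletonClass σ]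

/-- A fixed point is almost surely not in the configuration. -/
theorem ae_toMeasure_singleton (hPr : IsPoissonLaw σ Pr) (x : X) :
    ∀ᵐ ω ∂Pr, ω.toMeasure {x} = 0 := by
  have hx := measurableSet_singleton x
  have h := hPr.lintegral_count hx (by simp)
  rw [measure_singleton, lintegral_eq_zero_iff (Configuration.measurable_toMeasure_apply hx)] at h
  exact h

variable [SecondCountableTopology X] [SigmaCompactSpace X]

/-- Mecke's formula for functionals of the numbers of points in finitely many disjoint sets. -/
theorem lintegral_count_mul_of_disjoint (hPr : IsPoissonLaw σ Pr) {J : Type*} [Fintype J]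
    {C : J → Set X} (hC : ∀ j, MeasurableSet (C j)) (hd : Pairwise (Function.onFun Disjoint C))
    (hfin : ∀ j, σ (C j) ≠ ∞) (j : J) {F : (J → ℝ≥0∞) → ℝ≥0∞} (hF : Measurable F) :
    ∫⁻ ω, ω.toMeasure (C j) * F (fun k => ω.toMeasure (C k)) ∂Pr =
      ∫⁻ x in C j, ∫⁻ ω, F (fun k => (ω.addPoint x).toMeasure (C k)) ∂Pr ∂σ := by
  classical
  have hm : Measurable fun (ω : Configuration X) k => ω.toMeasure (C k) :=
    measurable_pi_lambda _ fun k => Configuration.measurable_toMeasure_apply (hC k)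
  have hu : Measurable fun z : J → ℝ≥0∞ => F (Function.update z j (z j + 1)) := by
    refine hF.comp (measurable_pi_lambda _ fun i => ?_)
    by_cases h : i = j
    · subst h; simpa using (measurable_pi_apply i).add_const 1
    · simpa [h] using measurable_pi_apply i
  have hL : ∫⁻ ω, ω.toMeasure (C j) * F (fun k => ω.toMeasure (C k)) ∂Pr =
      σ (C j) * ∫⁻ ω, F (Function.update (fun k => ω.toMeasure (C k)) j
        (ω.toMeasure (C j) + 1)) ∂Pr := by
    rw [← lintegral_map (f := fun z : J → ℝ≥0∞ => z j * F z) ((measurable_pi_apply j).mul hF) hm,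
      ← lintegral_map (f := fun z : J → ℝ≥0∞ => F (Function.update z j (z j + 1))) hu hm,
      hPr.map_counts hC hd hfin, lintegral_mul_pi_poissonMeasure _ j hF,
      ENNReal.coe_toNNReal (hfin j)]
  rw [hL, mul_comm, ← setLIntegral_const]
  refine setLIntegral_congr_fun (hC j) fun x hx => lintegral_congr_ae ?_
  filter_upwards [hPr.ae_toMeasure_singleton x] with ω hω
  congr 1
  funext k
  rw [Configuration.toMeasure_addPoint_apply_of_null hω (hC k)]
  by_cases h : k = j
  · subst h; simp [hx]
  · have : x ∉ C k := fun hk => Set.disjoint_left.1 (hd h) hk hx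
    simp [h, this]

end IsPoissonLaw

/-- The atoms of the algebra generated by the sets `B i` which lie in `⋃ i, B i`: the set of the
points which belong to `B i` exactly for `i ∈ T`. -/
def vennCell {X ι : Type*} (B : ι → Set X) (T : Finset ι) : Set X :=
  {x | (∃ i, x ∈ B i) ∧ ∀ i, x ∈ B i ↔ i ∈ T}

section vennCell

variable {X ι : Type*} (B : ι → Set X)

theorem pairwise_disjoint_vennCell : Pairwise (Function.onFun Disjoint (vennCell B)) := by
  intro S T hST
  refine Set.disjoint_left.2 fun x hS hT => hST ?_
  ext i
  rw [← hS.2 i, hT.2 i]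

variable [Fintype ι]

theorem eq_biUnion_vennCell [DecidableEq ι] (i : ι) :
    B i = ⋃ T ∈ (Finset.univ.filter fun T : Finset ι => i ∈ T), vennCell B T := by
  classical
  ext x
  simp only [Finset.mem_filter, Finset.mem_univ, true_and, Set.mem_iUnion, exists_prop]
  constructor
  · intro hx
    exact ⟨Finset.univ.filter fun k => x ∈ B k, by simpa using hx, ⟨i, hx⟩, by simp⟩
  · rintro ⟨T, hT, hx⟩
    exact (hx.2 i).2 hT

variable {B}

theorem measurableSet_vennCell [MeasurableSpace X] (hB : ∀ i, MeasurableSet (B i))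
    (T : Finset ι) : MeasurableSet (vennCell B T) := by
  have : vennCell B T = (⋃ i, B i) ∩ ⋂ i, {x | x ∈ B i ↔ i ∈ T} := by
    ext x; simp [vennCell]
  rw [this]
  exact (MeasurableSet.iUnion hB).inter
    (MeasurableSet.iInter fun i => (hB i).iff (MeasurableSet.const _))

theorem measure_vennCell_ne_top [MeasurableSpace X] {σ : Measure X} (hB : ∀ i, σ (B i) ≠ ∞)
    (T : Finset ι) : σ (vennCell B T) ≠ ∞ := by
  have h : vennCell B T ⊆ ⋃ i, B i := fun x hx => Set.mem_iUnion.2 hx.1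
  refine (((measure_mono h).trans (measure_iUnion_le B)).trans_lt ?_).ne
  rw [tsum_fintype]
  exact ENNReal.sum_lt_top.2 fun i _ => (hB i).lt_top

theorem measure_eq_sum_vennCell [DecidableEq ι] [MeasurableSpace X] (hB : ∀ i, MeasurableSet (B i))
    (μ : Measure X) (i : ι) :
    μ (B i) = ∑ T ∈ Finset.univ.filter (fun T : Finset ι => i ∈ T), μ (vennCell B T) := by
  conv_lhs => rw [eq_biUnion_vennCell B i]
  exact measure_biUnion_finset (fun S _ T _ h => pairwise_disjoint_vennCell B h)
    fun T _ => measurableSet_vennCell hB T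

end vennCell

namespace IsPoissonLaw

variable {X : Type*} [TopologicalSpace X] [MeasurableSpace X] {σ : Measure X}
  {Pr : Measure (Configuration X)}
  [T2Space X] [SecondCountableTopology X] [SigmaCompactSpace X] [BorelSpace X]
  [NullSingletonClass σ]

/-- Mecke's formula for functionals of the numbers of points in finitely many sets. -/
theorem lintegral_count_mul (hPr : IsPoissonLaw σ Pr) {ι : Type*} [Fintype ι]
    {B : ι → Set X} (hB : ∀ i, MeasurableSet (B i)) (hfin : ∀ i, σ (B i) ≠ ∞) (i : ι)
    {F : (ι → ℝ≥0∞) → ℝ≥0∞} (hF : Measurable F) :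
    ∫⁻ ω, ω.toMeasure (B i) * F (fun k => ω.toMeasure (B k)) ∂Pr =
      ∫⁻ x in B i, ∫⁻ ω, F (fun k => (ω.addPoint x).toMeasure (B k)) ∂Pr ∂σ := by
  classical
  let G : (Finset ι → ℝ≥0∞) → ℝ≥0∞ := fun z =>
    F fun k => ∑ T ∈ Finset.univ.filter (fun T : Finset ι => k ∈ T), z T
  have hG : Measurable G := hF.comp (by fun_prop)
  have hFG (ω : Configuration X) :
      F (fun k => ω.toMeasure (B k)) = G fun T => ω.toMeasure (vennCell B T) := by
    simp only [G]
    congr 1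
    funext k
    exact measure_eq_sum_vennCell hB _ k
  have hc := measurableSet_vennCell hB
  simp_rw [hFG]
  calc _ = ∫⁻ ω, ∑ T ∈ Finset.univ.filter (fun T : Finset ι => i ∈ T),
        ω.toMeasure (vennCell B T) * G (fun T => ω.toMeasure (vennCell B T)) ∂Pr := by
        simp_rw [measure_eq_sum_vennCell hB _ i, Finset.sum_mul]
    _ = ∑ T ∈ Finset.univ.filter (fun T : Finset ι => i ∈ T), ∫⁻ ω,
        ω.toMeasure (vennCell B T) * G (fun T => ω.toMeasure (vennCell B T)) ∂Pr := by
        refine lintegral_finsetSum _ fun T _ => ?_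
        exact (Configuration.measurable_toMeasure_apply (hc T)).mul (hG.comp
          (measurable_pi_lambda _ fun k => Configuration.measurable_toMeasure_apply (hc k)))
    _ = ∑ T ∈ Finset.univ.filter (fun T : Finset ι => i ∈ T), ∫⁻ x in vennCell B T,
        ∫⁻ ω, G (fun k => (ω.addPoint x).toMeasure (vennCell B k)) ∂Pr ∂σ :=
        Finset.sum_congr rfl fun T _ => hPr.lintegral_count_mul_of_disjoint hc
          (pairwise_disjoint_vennCell B) (measure_vennCell_ne_top hfin) T hG
    _ = _ := by
        conv_rhs => rw [eq_biUnion_vennCell B i]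
        rw [lintegral_biUnion_finset (fun S _ T _ h => pairwise_disjoint_vennCell B h)
          fun T _ => hc T]

end IsPoissonLaw

/-! ### Mecke's formula -/

namespace Configuration

variable {X : Type*} [TopologicalSpace X] [MeasurableSpace X]

/-- The counts of sets of finite measure already generate the σ-algebra of the configuration
space, since `σ` is σ-finite. -/
theorem measurableSpace_eq_iSup_comap (σ : Measure X) [SigmaFinite σ] :
    (inferInstance : MeasurableSpace (Configuration X)) =
      ⨆ B ∈ {B : Set X | MeasurableSet B ∧ σ B ≠ ∞},
        MeasurableSpace.comap (fun ω : Configuration X => ω.toMeasure B) inferInstance := by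
  refine le_antisymm (iSup₂_le fun A hA => ?_) (iSup₂_le fun B hB => ?_)
  · rw [← measurable_iff_comap_le]
    have hm := fun n => MeasurableSet.disjointed (measurableSet_spanningSets σ) n
    have h : (fun ω : Configuration X => ω.toMeasure A) =
        fun ω => ∑' n, ω.toMeasure (A ∩ disjointed (spanningSets σ) n) := by
      funext ω
      rw [← measure_iUnion _ fun n => hA.inter (hm n), ← Set.inter_iUnion, iUnion_disjointed,
        iUnion_spanningSets, Set.inter_univ]
      exact fun i j hij => (disjoint_disjointed _ hij).mono Set.inter_subset_right
        Set.inter_subset_right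
    rw [h]
    -- stated for every σ-algebra, since the one on the right-hand side is not the instance
    have htsum : ∀ (m : MeasurableSpace (Configuration X)) (g : ℕ → Configuration X → ℝ≥0∞),
        (∀ n, Measurable (g n)) → Measurable fun ω => ∑' n, g n ω := fun m g hg =>
      Measurable.tsum hg
    refine htsum _ _ fun n => ?_
    refine Measurable.of_comap_le ?_
    have hn : A ∩ disjointed (spanningSets σ) n ∈ {B : Set X | MeasurableSet B ∧ σ B ≠ ∞} := by
      refine ⟨hA.inter (hm n), (lt_of_le_of_lt (measure_mono ?_)
        (measure_spanningSets_lt_top σ n)).ne⟩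
      exact Set.inter_subset_right.trans (disjointed_subset _ _)
    exact le_iSup₂_of_le (f := fun (B : Set X) (_ : B ∈ {B : Set X | MeasurableSet B ∧ σ B ≠ ∞}) =>
      MeasurableSpace.comap (fun ω : Configuration X => ω.toMeasure B) inferInstance) _ hn le_rfl
  · exact (measurable_toMeasure_apply hB.1).comap_le

end Configuration

namespace IsPoissonLaw

open Configuration

variable {X : Type*} [TopologicalSpace X] [MeasurableSpace X] {σ : Measure X}
  {Pr : Measure (Configuration X)}
  [T2Space X] [SecondCountableTopology X] [SigmaCompactSpace X] [BorelSpace X]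
  [NullSingletonClass σ] [SigmaFinite σ]

/-- Mecke's formula for `f(x, ω) = 1_A(x) 1_E(ω)` with `σ(A) < ∞`. -/
theorem setLIntegral_count (hPr : IsPoissonLaw σ Pr) {A : Set X} (hA : MeasurableSet A)
    (hfin : σ A ≠ ∞) {E : Set (Configuration X)} (hE : MeasurableSet E) :
    ∫⁻ ω in E, ω.toMeasure A ∂Pr = ∫⁻ x in A, Pr ((fun ω => ω.addPoint x) ⁻¹' E) ∂σ := by
  classical
  have := hPr.isProbabilityMeasure
  have hadd : Measurable fun p : X × Configuration X => p.2.addPoint p.1 :=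
    measurable_addPoint.comp measurable_swap
  -- both sides are finite measures in `E`
  let μ : Measure (Configuration X) := Pr.withDensity fun ω => ω.toMeasure A
  let ν : Measure (Configuration X) := ((σ.restrict A).prod Pr).map fun p => p.2.addPoint p.1
  have hμ : ∀ E, MeasurableSet E → μ E = ∫⁻ ω in E, ω.toMeasure A ∂Pr := fun E hE =>
    withDensity_apply _ hE
  have hν : ∀ E, MeasurableSet E →
      ν E = ∫⁻ x in A, Pr ((fun ω => ω.addPoint x) ⁻¹' E) ∂σ := fun E hE => by
    simp only [ν]
    rw [Measure.map_apply hadd hE, Measure.prod_apply (hadd hE)]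
    rfl
  rw [← hμ E hE, ← hν E hE]
  have hμu : μ Set.univ = σ A := by
    rw [hμ _ MeasurableSet.univ, setLIntegral_univ, hPr.lintegral_count hA hfin]
  have hνu : ν Set.univ = σ A := by
    rw [hν _ MeasurableSet.univ]; simp
  have : IsFiniteMeasure μ := ⟨by rw [hμu]; exact hfin.lt_top⟩
  suffices h : μ = ν by rw [h]
  let m : Set X → MeasurableSpace (Configuration X) := fun B =>
    MeasurableSpace.comap (fun ω : Configuration X => ω.toMeasure B) inferInstance
  refine ext_of_generate_finite
    (piiUnionInter (fun B : Set X => {s | MeasurableSet[m B] s})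
      {B : Set X | MeasurableSet B ∧ σ B ≠ ∞}) ?_ ?_ ?_ (hμu.trans hνu.symm)
  · exact (measurableSpace_eq_iSup_comap σ).trans
      (generateFrom_piiUnionInter_measurableSet m _).symm
  · exact isPiSystem_piiUnionInter _
      (fun B => @MeasurableSpace.isPiSystem_measurableSet _ (m B)) _
  · rintro _ ⟨t, ht, g, hg, rfl⟩
    choose! s hs hsg using hg
    -- the event `⋂ B ∈ t, g B` is a functional of the counts of `A` and of the sets in `t`
    let B : {B // B ∈ insert A t} → Set X := Subtype.val
    have hB : ∀ i, MeasurableSet (B i) ∧ σ (B i) ≠ ∞ := by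
      rintro ⟨C, hC⟩
      rcases Finset.mem_insert.1 hC with rfl | hC
      · exact ⟨hA, hfin⟩
      · exact ht hC
    let S : Set ({B // B ∈ insert A t} → ℝ≥0∞) := {z | ∀ i, B i ∈ t → z i ∈ s (B i)}
    have hS : MeasurableSet S := by
      have : S = ⋂ i, {z | B i ∈ t → z i ∈ s (B i)} := by ext; simp [S]
      rw [this]
      refine MeasurableSet.iInter fun i => ?_
      by_cases h : B i ∈ t
      · have hi : MeasurableSet (s (B i)) := hs _ h
        have hz : Measurable fun z : {B // B ∈ insert A t} → ℝ≥0∞ => z i := measurable_pi_apply i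
        simp only [h, true_imp_iff]
        exact hz hi
      · simp [h]
    have hgS : (⋂ C ∈ t, g C) = (fun (ω : Configuration X) i => ω.toMeasure (B i)) ⁻¹' S := by
      ext ω
      simp only [Set.mem_iInter, Set.mem_preimage, S, Set.mem_ofPred_eq]
      constructor
      · intro h i hi
        have := h _ hi
        rw [← hsg _ hi] at this
        exact this
      · intro h C hC
        rw [← hsg _ hC]
        exact h ⟨C, Finset.mem_insert_of_mem hC⟩ hC
    have hcount : Measurable fun (ω : Configuration X) i => ω.toMeasure (B i) :=
      measurable_pi_lambda _ fun i => measurable_toMeasure_apply (hB i).1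
    have hE : MeasurableSet (⋂ C ∈ t, g C) := hgS ▸ hcount hS
    rw [hμ _ hE, hν _ hE]
    have key := hPr.lintegral_count_mul (fun i => (hB i).1) (fun i => (hB i).2)
      ⟨A, Finset.mem_insert_self A t⟩ (F := S.indicator 1) (measurable_one.indicator hS)
    have hL : ∫⁻ ω in ⋂ C ∈ t, g C, ω.toMeasure A ∂Pr =
        ∫⁻ ω, ω.toMeasure A * S.indicator 1 (fun i => ω.toMeasure (B i)) ∂Pr := by
      rw [← lintegral_indicator hE]
      refine lintegral_congr fun ω => ?_
      rw [hgS]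
      by_cases h : (fun i => ω.toMeasure (B i)) ∈ S
      · rw [Set.indicator_of_mem h, Set.indicator_of_mem (by exact h)]; simp
      · rw [Set.indicator_of_notMem h, Set.indicator_of_notMem (by exact h)]; simp
    rw [hL]
    refine key.trans (lintegral_congr fun x => ?_)
    have hx : Measurable fun ω : Configuration X => ω.addPoint x :=
      hadd.comp (measurable_const.prodMk measurable_id)
    rw [← lintegral_indicator_one (hx hE)]
    refine lintegral_congr fun ω => ?_
    rw [hgS]
    rfl

/-- Mecke's formula: the measures `ω(dx) ℙ(dω)` on the one hand, and the image of `σ ⊗ ℙ` under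
`(x, ω) ↦ (ω ∪ {x}, x)` on the other hand, coincide. -/
theorem compProd_toKernel (hPr : IsPoissonLaw σ Pr) :
    Pr ⊗ₘ toKernel X = (Pr.prod σ).map fun p => (p.1.addPoint p.2, p.2) := by
  have := hPr.isProbabilityMeasure
  have hadd : Measurable fun p : Configuration X × X => (p.1.addPoint p.2, p.2) :=
    measurable_addPoint.prodMk measurable_snd
  have key : ∀ {E : Set (Configuration X)} {A : Set X}, MeasurableSet E → MeasurableSet A →
      σ A ≠ ∞ → (Pr ⊗ₘ toKernel X) (E ×ˢ A) =
        ((Pr.prod σ).map fun p => (p.1.addPoint p.2, p.2)) (E ×ˢ A) := by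
    intro E A hE hA hfin
    rw [Measure.compProd_apply_prod hE hA, Measure.map_apply hadd (hE.prod hA),
      Measure.prod_apply_symm (hadd (hE.prod hA))]
    refine (hPr.setLIntegral_count hA hfin hE).trans ?_
    rw [← lintegral_indicator hA]
    refine lintegral_congr fun x => ?_
    by_cases hx : x ∈ A
    · rw [Set.indicator_of_mem hx]
      congr 1
      ext ω
      simp [hx]
    · rw [Set.indicator_of_notMem hx]
      simp [Set.preimage, hx]
  -- rectangles determine finite measures only, hence the exhaustion by sets of finite measure
  refine Measure.ext_of_iUnion_eq_univ
    (s := fun n => (Set.univ : Set (Configuration X)) ×ˢ spanningSets σ n) ?_ fun n => ?_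
  · rw [← Set.prod_iUnion, iUnion_spanningSets, Set.univ_prod_univ]
  · have hn := measurableSet_spanningSets σ n
    have hfin := (measure_spanningSets_lt_top σ n).ne
    have : IsFiniteMeasure ((Pr ⊗ₘ toKernel X).restrict
        ((Set.univ : Set (Configuration X)) ×ˢ spanningSets σ n)) := by
      refine ⟨?_⟩
      rw [Measure.restrict_apply_univ, Measure.compProd_apply_prod MeasurableSet.univ hn,
        setLIntegral_univ]
      exact (hPr.lintegral_count hn hfin).trans_lt hfin.lt_top
    refine Measure.ext_prod fun {E A} hE hA => ?_
    rw [Measure.restrict_apply (hE.prod hA), Measure.restrict_apply (hE.prod hA),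
      Set.prod_inter_prod, Set.inter_univ]
    exact key hE (hA.inter hn)
      (lt_of_le_of_lt (measure_mono Set.inter_subset_right) hfin.lt_top).ne

/-- Mecke's formula `E ∫ f(x, ω) ω(dx) = ∫ E f(x, ω ∪ {x}) σ(dx)`. -/
theorem lintegral_lintegral_toMeasure (hPr : IsPoissonLaw σ Pr)
    {f : X → Configuration X → ℝ≥0∞}
    (hf : Measurable fun p : X × Configuration X => f p.1 p.2) :
    ∫⁻ ω, ∫⁻ x, f x ω ∂ω.toMeasure ∂Pr = ∫⁻ x, ∫⁻ ω, f x (ω.addPoint x) ∂Pr ∂σ := by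
  have := hPr.isProbabilityMeasure
  have hf' : Measurable fun p : Configuration X × X => f p.2 p.1 := hf.comp measurable_swap
  have hadd : Measurable fun p : Configuration X × X => (p.1.addPoint p.2, p.2) :=
    measurable_addPoint.prodMk measurable_snd
  have h := Measure.lintegral_compProd (μ := Pr) (κ := toKernel X) hf'
  rw [hPr.compProd_toKernel, lintegral_map hf' hadd] at h
  exact h.symm.trans (lintegral_prod_symm
    (f := fun p : Configuration X × X => f p.2 (p.1.addPoint p.2)) (hf'.comp hadd).aemeasurable)

end IsPoissonLaw

/-! ### The multivariate Mecke formula off the diagonals -/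

namespace MeasureTheory

/-- Tonelli's theorem for the first coordinate of a product over `Fin (n + 1)`. -/
theorem lintegral_pi_fin_succ {X : Type*} [MeasurableSpace X] {n : ℕ} (μ : Fin (n + 1) → Measure X)
    [∀ i, SigmaFinite (μ i)] {G : (Fin (n + 1) → X) → ℝ≥0∞} (hG : Measurable G) :
    ∫⁻ y, G y ∂Measure.pi μ =
      ∫⁻ x, ∫⁻ y, G (Fin.cons x y) ∂(Measure.pi fun i : Fin n => μ i.succ) ∂μ 0 := by
  have h := (measurePreserving_piFinSuccAbove μ 0).symm
  rw [← h.lintegral_comp_emb (MeasurableEquiv.measurableEmbedding _), lintegral_prod]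
  · simp [MeasurableEquiv.piFinSuccAbove]
    rfl
  · exact (hG.comp (MeasurableEquiv.measurable _)).aemeasurable

theorem measurable_fin_cons {X : Type*} [MeasurableSpace X] {n : ℕ} :
    Measurable fun p : X × (Fin n → X) => (Fin.cons p.1 p.2 : Fin (n + 1) → X) := by
  refine measurable_pi_lambda _ fun i => ?_
  refine Fin.cases ?_ (fun i => ?_) i
  · simpa using measurable_fst
  · simpa [Function.comp_def] using (measurable_pi_apply i).comp measurable_snd

/-- The integral against a finite product of s-finite kernels with σ-finite values depends
measurably on the parameter. -/
theorem measurable_lintegral_pi_kernel {X : Type u} [MeasurableSpace X] (n : ℕ) :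
    ∀ {Z : Type u} [MeasurableSpace Z] (κ : Fin n → Kernel Z X) [∀ i, IsSFiniteKernel (κ i)]
      [∀ i z, SigmaFinite (κ i z)] {F : Z → (Fin n → X) → ℝ≥0∞},
      (Measurable fun p : Z × (Fin n → X) => F p.1 p.2) →
      Measurable fun z => ∫⁻ y, F z y ∂(Measure.pi fun i => κ i z) := by
  induction n with
  | zero =>
    intro Z _ κ _ _ F hF
    have h0 (z : Z) : (Measure.pi fun i => κ i z) = Measure.dirac isEmptyElim :=
      Measure.pi_of_empty _
    simp only [h0, lintegral_dirac]
    exact hF.comp (measurable_id.prodMk measurable_const)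
  | succ n ih =>
    intro Z _ κ _ _ F hF
    have h (z : Z) : ∫⁻ y, F z y ∂(Measure.pi fun i => κ i z) =
        ∫⁻ x, ∫⁻ y, F z (Fin.cons x y) ∂(Measure.pi fun i : Fin n => κ i.succ z) ∂κ 0 z :=
      lintegral_pi_fin_succ _ (hF.comp (measurable_const.prodMk measurable_id))
    simp_rw [h]
    have hF' : Measurable fun p : (Z × X) × (Fin n → X) => F p.1.1 (Fin.cons p.1.2 p.2) :=
      hF.comp ((measurable_fst.comp measurable_fst).prodMk
        (measurable_fin_cons.comp ((measurable_snd.comp measurable_fst).prodMk measurable_snd)))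
    let η : Fin n → Kernel (Z × X) X := fun i => (κ i.succ).comap Prod.fst measurable_fst
    have hη : ∀ i z, η i z = κ i.succ z.1 := fun i z => Kernel.comap_apply _ measurable_fst z
    have : ∀ i, IsSFiniteKernel (η i) := fun i => by simp only [η]; infer_instance
    have : ∀ i z, SigmaFinite (η i z) := fun i z => by rw [hη]; infer_instance
    have := ih η (F := fun q y => F q.1 (Fin.cons q.2 y)) hF'
    simp only [hη] at this
    exact this.lintegral_kernel_prod_right'

end MeasureTheory

section offDiagonal

variable {X : Type*}

theorem measurableSet_offDiagonal (ι : Type*) [Countable ι] [TopologicalSpace X] [T2Space X]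
    [SecondCountableTopology X] [MeasurableSpace X] [BorelSpace X] :
    MeasurableSet (offDiagonal ι X) := by
  have : offDiagonal ι X = ⋂ i, ⋂ j, {y : ι → X | i ≠ j → y i ≠ y j} := by
    ext; simp [offDiagonal]
  rw [this]
  refine MeasurableSet.iInter fun i => MeasurableSet.iInter fun j => ?_
  by_cases h : i = j
  · simp [h]
  · simp only [ne_eq, h, not_false_eq_true, true_imp_iff]
    exact (measurableSet_eq_fun (measurable_pi_apply i) (measurable_pi_apply j)).compl

theorem cons_mem_offDiagonal_iff {n : ℕ} {x : X} {y : Fin n → X} :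
    (Fin.cons x y : Fin (n + 1) → X) ∈ offDiagonal (Fin (n + 1)) X ↔
      y ∈ offDiagonal (Fin n) X ∧ y ∈ Set.univ.pi fun _ => ({x}ᶜ : Set X) := by
  simp only [offDiagonal, Set.mem_ofPred_eq, Fin.forall_fin_succ, Fin.cons_zero, Fin.cons_succ,
    Set.mem_pi, Set.mem_univ, true_imp_iff, Set.mem_compl_iff, Set.mem_singleton_iff, ne_eq,
    not_true_eq_false, IsEmpty.forall_iff, true_and, Fin.succ_inj, (Fin.succ_ne_zero _).symm,
    Fin.succ_ne_zero, not_false_eq_true]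
  constructor
  · rintro ⟨-, h⟩
    exact ⟨fun i j => (h i).2 j, fun i => (h i).1⟩
  · rintro ⟨h1, h2⟩
    exact ⟨fun i h => h2 i h.symm, fun i => ⟨h2 i, h1 i⟩⟩

variable [TopologicalSpace X] [T2Space X] [SecondCountableTopology X] [MeasurableSpace X]
  [BorelSpace X]

theorem setLIntegral_offDiagonal_succ {n : ℕ} (μ : Fin (n + 1) → Measure X)
    [∀ i, SigmaFinite (μ i)] {g : (Fin (n + 1) → X) → ℝ≥0∞} (hg : Measurable g) :
    ∫⁻ y in offDiagonal (Fin (n + 1)) X, g y ∂Measure.pi μ =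
      ∫⁻ x, ∫⁻ y in offDiagonal (Fin n) X,
        (Set.univ.pi fun _ => ({x}ᶜ : Set X)).indicator (fun y => g (Fin.cons x y)) y
        ∂(Measure.pi fun i : Fin n => μ i.succ) ∂μ 0 := by
  rw [← lintegral_indicator (measurableSet_offDiagonal _),
    lintegral_pi_fin_succ μ (hg.indicator (measurableSet_offDiagonal _))]
  refine lintegral_congr fun x => ?_
  rw [← lintegral_indicator (measurableSet_offDiagonal _)]
  refine lintegral_congr fun y => ?_
  by_cases h1 : y ∈ offDiagonal (Fin n) X <;>
    by_cases h2 : y ∈ Set.univ.pi fun _ => ({x}ᶜ : Set X) <;>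
    simp only [Set.indicator, cons_mem_offDiagonal_iff, h1, h2, and_self, and_false, false_and,
      if_true, if_false]

end offDiagonal

section mixedMeasure

variable {X : Type*} [TopologicalSpace X] [MeasurableSpace X]

/-- The kernel `ω ↦ ω_e`, where `ω₁ = ω` and `ω₀ = σ`. -/
noncomputable def mixedKernel (σ : Measure X) (e : Fin 2) : Kernel (Configuration X) X :=
  if e = 1 then Configuration.toKernel X else Kernel.const _ σ

theorem mixedKernel_apply (σ : Measure X) (e : Fin 2) (ω : Configuration X) :
    mixedKernel σ e ω = mixedMeasure σ ω e := by
  unfold mixedKernel mixedMeasure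
  split_ifs <;> simp

variable [T2Space X] [SecondCountableTopology X] [SigmaCompactSpace X] [BorelSpace X]

instance sigmaFinite_mixedMeasure (σ : Measure X) [SigmaFinite σ] (ω : Configuration X)
    (e : Fin 2) : SigmaFinite (mixedMeasure σ ω e) := by
  unfold mixedMeasure
  split_ifs <;> infer_instance

instance isSFiniteKernel_mixedKernel (σ : Measure X) [SFinite σ] (e : Fin 2) :
    IsSFiniteKernel (mixedKernel σ e) := by
  unfold mixedKernel
  split_ifs <;> infer_instance

theorem restrict_mixedMeasure_addPoint (σ : Measure X) (ω : Configuration X) (x : X)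
    (e : Fin 2) :
    (mixedMeasure σ (ω.addPoint x) e).restrict {x}ᶜ = (mixedMeasure σ ω e).restrict {x}ᶜ := by
  unfold mixedMeasure
  split_ifs
  · exact ω.restrict_toMeasure_addPoint x
  · rfl

end mixedMeasure

theorem measurable_lintegral_pi_mixedMeasure {X : Type u} [TopologicalSpace X] [T2Space X]
    [SecondCountableTopology X] [SigmaCompactSpace X] [MeasurableSpace X] [BorelSpace X]
    (σ : Measure X) [SigmaFinite σ] {n : ℕ} (ε : Fin n → Fin 2) {Z : Type u} [MeasurableSpace Z]
    {c : Z → Configuration X} (hc : Measurable c) {F : Z → (Fin n → X) → ℝ≥0∞}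
    (hF : Measurable fun p : Z × (Fin n → X) => F p.1 p.2) :
    Measurable fun z => ∫⁻ y, F z y ∂(Measure.pi fun i => mixedMeasure σ (c z) (ε i)) := by
  have : ∀ (i : Fin n) (z : Z), SigmaFinite ((mixedKernel σ (ε i)).comap c hc z) := fun i z => by
    rw [Kernel.comap_apply, mixedKernel_apply]; infer_instance
  have := measurable_lintegral_pi_kernel n (fun i => (mixedKernel σ (ε i)).comap c hc) hF
  simpa only [Kernel.comap_apply, mixedKernel_apply] using this

namespace Configuration

variable {X : Type*} [TopologicalSpace X]

theorem addPoint_unionFinite_image_cons {n : ℕ} (ω : Configuration X) (x : X) (y : Fin n → X)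
    {ε : Fin (n + 1) → Fin 2} (h : ε 0 = 1) :
    (ω.unionFinite (y '' {i | ε i.succ = 1}) (Set.toFinite _)).addPoint x =
      ω.unionFinite ((Fin.cons x y : Fin (n + 1) → X) '' {i | ε i = 1}) (Set.toFinite _) := by
  simp only [addPoint, unionFinite, Configuration.mk.injEq, Set.union_assoc]
  congr 1
  ext z
  simp only [Set.mem_union, Set.mem_image, Set.mem_ofPred_eq, Set.mem_singleton_iff,
    Fin.exists_fin_succ, Fin.cons_zero, Fin.cons_succ, h, true_and]
  rw [or_comm, eq_comm]

theorem unionFinite_image_cons {n : ℕ} (ω : Configuration X) (x : X) (y : Fin n → X)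
    {ε : Fin (n + 1) → Fin 2} (h : ε 0 ≠ 1) :
    ω.unionFinite (y '' {i | ε i.succ = 1}) (Set.toFinite _) =
      ω.unionFinite ((Fin.cons x y : Fin (n + 1) → X) '' {i | ε i = 1}) (Set.toFinite _) := by
  simp only [unionFinite, Configuration.mk.injEq]
  congr 1
  ext z
  simp only [Set.mem_image, Set.mem_ofPred_eq,
    Fin.exists_fin_succ, Fin.cons_zero, Fin.cons_succ, h, false_and, false_or]

theorem measurable_unionFinite_image [T2Space X] [SecondCountableTopology X]
    [SigmaCompactSpace X] [MeasurableSpace X] [BorelSpace X] {ι : Type*} [Finite ι] (T : Set ι) :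
    Measurable fun p : (ι → X) × Configuration X =>
      p.2.unionFinite (p.1 '' T) ((Set.toFinite T).image p.1) := by
  induction T, Set.toFinite T using Set.Finite.induction_on with
  | empty =>
    have : (fun p : (ι → X) × Configuration X =>
        p.2.unionFinite (p.1 '' ∅) ((Set.toFinite ∅).image p.1)) = Prod.snd := by
      funext p; simp [unionFinite]
    rw [this]
    exact measurable_snd
  | @insert i T _ _ ih =>
    have : (fun p : (ι → X) × Configuration X =>
        p.2.unionFinite (p.1 '' insert i T) ((Set.toFinite (insert i T)).image p.1)) =
        fun p => (p.2.unionFinite (p.1 '' T) ((Set.toFinite T).image p.1)).addPoint (p.1 i) := by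
      funext p
      simp only [addPoint, unionFinite, Set.image_insert_eq, Set.union_singleton,
        Set.union_insert]
    rw [this]
    exact measurable_addPoint.comp (ih.prodMk ((measurable_pi_apply i).comp measurable_fst))

end Configuration

/-- The multivariate Mecke formula: off the diagonals, every integration against `ω` becomes an
integration against `σ` at the price of adding the corresponding point to `ω`. -/
theorem IsPoissonLaw.lintegral_offDiagonal {X : Type u} [TopologicalSpace X] [T2Space X]
    [SecondCountableTopology X] [SigmaCompactSpace X] [MeasurableSpace X] [BorelSpace X]
    {σ : Measure X} [SigmaFinite σ] [NullSingletonClass σ]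
    {Pr : Measure (Configuration X)} (hPr : IsPoissonLaw σ Pr) (n : ℕ) :
    ∀ (ε : Fin n → Fin 2) {g : (Fin n → X) → Configuration X → ℝ≥0∞},
      (Measurable fun p : (Fin n → X) × Configuration X => g p.1 p.2) →
      ∫⁻ ω, ∫⁻ y in offDiagonal (Fin n) X, g y ω
          ∂(Measure.pi fun i => mixedMeasure σ ω (ε i)) ∂Pr =
        ∫⁻ y in offDiagonal (Fin n) X,
          ∫⁻ ω, g y (ω.unionFinite (y '' {i | ε i = 1}) (Set.toFinite _)) ∂Pr
          ∂(Measure.pi fun _ => σ) := by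
  have := hPr.isProbabilityMeasure
  induction n with
  | zero =>
    intro ε g hg
    have h : offDiagonal (Fin 0) X = Set.univ := by ext; simp [offDiagonal]
    have hω (ω : Configuration X) (y : Fin 0 → X) :
        ω.unionFinite (y '' {i | ε i = 1}) (Set.toFinite _) = ω := by
      simp [Configuration.unionFinite, Set.eq_empty_of_isEmpty]
    have h0 (μ : Fin 0 → Measure X) : Measure.pi μ = Measure.dirac isEmptyElim :=
      Measure.pi_of_empty _
    simp only [h, Measure.restrict_univ, h0, lintegral_dirac, hω]
  | succ n ih =>
    intro ε g hg
    have hD := measurableSet_offDiagonal (X := X) (Fin n)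
    let H : X → (Fin n → X) → Configuration X → ℝ≥0∞ := fun x y ω =>
      (Set.univ.pi fun _ => ({x}ᶜ : Set X)).indicator (fun y => g (Fin.cons x y) ω) y
    have hH : Measurable fun p : X × (Fin n → X) × Configuration X => H p.1 p.2.1 p.2.2 := by
      have hs : MeasurableSet {p : X × (Fin n → X) × Configuration X |
          p.2.1 ∈ Set.univ.pi fun _ => ({p.1}ᶜ : Set X)} := by
        simp only [Set.mem_pi, Set.mem_univ, true_imp_iff, Set.mem_compl_iff,
          Set.mem_singleton_iff, Set.ofPred_forall]
        refine MeasurableSet.iInter fun i => (measurableSet_eq_fun ?_ ?_).compl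
        · exact (measurable_pi_apply i).comp (measurable_fst.comp measurable_snd)
        · exact measurable_fst
      have hg' : Measurable fun p : X × (Fin n → X) × Configuration X =>
          g (Fin.cons p.1 p.2.1) p.2.2 :=
        hg.comp ((measurable_fin_cons.comp (measurable_fst.prodMk
          (measurable_fst.comp measurable_snd))).prodMk (measurable_snd.comp measurable_snd))
      exact hg'.indicator hs
    have hHx (x : X) : Measurable fun p : (Fin n → X) × Configuration X => H x p.1 p.2 :=
      hH.comp (measurable_const.prodMk measurable_id)
    let Φ : X → Configuration X → ℝ≥0∞ := fun x ω =>
      ∫⁻ y in offDiagonal (Fin n) X, H x y ω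
        ∂(Measure.pi fun i : Fin n => mixedMeasure σ ω (ε i.succ))
    have hΦ : Measurable fun p : X × Configuration X => Φ p.1 p.2 := by
      simp only [Φ, ← lintegral_indicator hD]
      refine measurable_lintegral_pi_mixedMeasure σ (fun i : Fin n => ε i.succ) measurable_snd ?_
      refine Measurable.indicator (s := {p : (X × Configuration X) × (Fin n → X) |
        p.2 ∈ offDiagonal (Fin n) X}) ?_ (hD.preimage measurable_snd)
      exact hH.comp ((measurable_fst.comp measurable_fst).prodMk
        (measurable_snd.prodMk (measurable_snd.comp measurable_fst)))
    have hL : ∫⁻ ω, ∫⁻ y in offDiagonal (Fin (n + 1)) X, g y ω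
          ∂(Measure.pi fun i => mixedMeasure σ ω (ε i)) ∂Pr =
        ∫⁻ ω, ∫⁻ x, Φ x ω ∂mixedMeasure σ ω (ε 0) ∂Pr :=
      lintegral_congr fun ω => setLIntegral_offDiagonal_succ _
        (hg.comp (measurable_id.prodMk measurable_const))
    have hU : Measurable fun p : (Fin (n + 1) → X) × Configuration X =>
        g p.1 (p.2.unionFinite (p.1 '' {i | ε i = 1}) (Set.toFinite _)) :=
      hg.comp (measurable_fst.prodMk (Configuration.measurable_unionFinite_image _))
    have hR : ∫⁻ y in offDiagonal (Fin (n + 1)) X,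
          ∫⁻ ω, g y (ω.unionFinite (y '' {i | ε i = 1}) (Set.toFinite _)) ∂Pr
          ∂(Measure.pi fun _ => σ) =
        ∫⁻ x, ∫⁻ y in offDiagonal (Fin n) X, ∫⁻ ω, H x y (ω.unionFinite
          ((Fin.cons x y : Fin (n + 1) → X) '' {i | ε i = 1}) (Set.toFinite _)) ∂Pr
          ∂(Measure.pi fun _ => σ) ∂σ := by
      rw [setLIntegral_offDiagonal_succ _ hU.lintegral_prod_right']
      refine lintegral_congr fun x => lintegral_congr fun y => ?_
      by_cases h : y ∈ Set.univ.pi fun _ => ({x}ᶜ : Set X)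
      · simp only [H, Set.indicator_of_mem h]
      · simp only [H, Set.indicator_of_notMem h, lintegral_zero]
    rw [hL, hR]
    by_cases h0 : ε 0 = 1
    · have h1 : ∀ ω : Configuration X, mixedMeasure σ ω (ε 0) = ω.toMeasure := fun ω => by
        simp [mixedMeasure, h0]
      simp_rw [h1]
      rw [hPr.lintegral_lintegral_toMeasure hΦ]
      refine lintegral_congr fun x => ?_
      -- `H x` lives on the product of the sets `{x}ᶜ`, where `ω ∪ {x}` and `ω` agree
      have hadd : ∀ ω : Configuration X, Φ x (ω.addPoint x) =
          ∫⁻ y in offDiagonal (Fin n) X, H x y (ω.addPoint x)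
            ∂(Measure.pi fun i : Fin n => mixedMeasure σ ω (ε i.succ)) := by
        intro ω
        have hpi : MeasurableSet (Set.univ.pi fun _ : Fin n => ({x}ᶜ : Set X)) :=
          MeasurableSet.univ_pi fun _ => (measurableSet_singleton x).compl
        simp only [Φ, H]
        rw [lintegral_indicator hpi, lintegral_indicator hpi, Measure.restrict_restrict hpi,
          Measure.restrict_restrict hpi, Set.inter_comm, ← Measure.restrict_restrict hD,
          ← Measure.restrict_restrict hD, Measure.restrict_pi_pi, Measure.restrict_pi_pi]
        simp_rw [restrict_mixedMeasure_addPoint]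
      simp_rw [hadd]
      rw [ih (fun i => ε i.succ) (g := fun y ω => H x y (ω.addPoint x))
        ((hHx x).comp (measurable_fst.prodMk (Configuration.measurable_addPoint.comp
          (measurable_snd.prodMk measurable_const))))]
      refine lintegral_congr fun y => lintegral_congr fun ω => ?_
      rw [Configuration.addPoint_unionFinite_image_cons ω x y h0]
    · have h1 : ∀ ω : Configuration X, mixedMeasure σ ω (ε 0) = σ := fun ω => by
        simp [mixedMeasure, h0]
      simp_rw [h1]
      rw [lintegral_lintegral_swap (f := fun ω x => Φ x ω) (hΦ.comp measurable_swap).aemeasurable]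
      refine lintegral_congr fun x => ?_
      simp only [Φ]
      rw [ih (fun i => ε i.succ) (g := fun y ω => H x y ω) (hHx x)]
      refine lintegral_congr fun y => lintegral_congr fun ω => ?_
      rw [Configuration.unionFinite_image_cons ω x y h0]

/-! ### Product measures on diagonals -/

namespace MeasureTheory

/-- A product measure over `ι`, regrouped along the fibres of a map `p : ι → κ`. -/
theorem Measure.map_pi_fiber {X ι κ : Type*} [MeasurableSpace X] [Fintype ι] [Fintype κ]
    [DecidableEq κ] (p : ι → κ) (μ : ι → Measure X) [∀ i, SigmaFinite (μ i)] :
    (Measure.pi fun k => Measure.pi fun i : {i // p i = k} => μ i).map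
      (fun w i => w (p i) ⟨i, rfl⟩) = Measure.pi μ := by
  classical
  refine (Measure.pi_eq fun s hs => ?_).symm
  have hm : Measurable fun (w : (k : κ) → {i // p i = k} → X) i => w (p i) ⟨i, rfl⟩ :=
    measurable_pi_lambda _ fun i => (measurable_pi_apply (⟨i, rfl⟩ : {j // p j = p i})).comp
      (measurable_pi_apply (p i))
  have hpre : (fun (w : (k : κ) → {i // p i = k} → X) i => w (p i) ⟨i, rfl⟩) ⁻¹' Set.univ.pi s =
      Set.univ.pi fun k => Set.univ.pi fun i : {i // p i = k} => s i := by
    ext w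
    simp only [Set.mem_preimage, Set.mem_pi, Set.mem_univ, true_imp_iff, Subtype.forall]
    exact ⟨by rintro h k i rfl; exact h i, fun h i => h (p i) i rfl⟩
  rw [Measure.map_apply hm (MeasurableSet.univ_pi hs), hpre, Measure.pi_pi]
  simp_rw [Measure.pi_pi]
  exact Fintype.prod_fiberwise p fun i => μ i (s i)

/-- If on every fibre of `p` the product measure restricted to the small diagonal is the image of
`ν k` under the diagonal embedding, then the restriction of the product measure to the vectors
that are constant on the fibres of `p` is the image of the product of the `ν k`. -/
theorem Measure.restrict_pi_const_on_fibers {X ι κ : Type*} [MeasurableSpace X] [Fintype ι]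
    [Fintype κ] [DecidableEq κ] (p : ι → κ) (μ : ι → Measure X) [∀ i, SigmaFinite (μ i)]
    (ν : κ → Measure X) (hD : MeasurableSet {x : ι → X | ∀ i j, p i = p j → x i = x j})
    (h : ∀ k, (Measure.pi fun i : {i // p i = k} => μ i).restrict {w | ∀ i j, w i = w j} =
      (ν k).map fun x _ => x) :
    (Measure.pi μ).restrict {x | ∀ i j, p i = p j → x i = x j} =
      (Measure.pi ν).map fun y i => y (p i) := by
  have hm : Measurable fun (w : (k : κ) → {i // p i = k} → X) i => w (p i) ⟨i, rfl⟩ :=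
    measurable_pi_lambda _ fun i => (measurable_pi_apply (⟨i, rfl⟩ : {j // p j = p i})).comp
      (measurable_pi_apply (p i))
  have hpre : (fun (w : (k : κ) → {i // p i = k} → X) i => w (p i) ⟨i, rfl⟩) ⁻¹'
        {x : ι → X | ∀ i j, p i = p j → x i = x j} =
      Set.univ.pi fun k => {w : {i // p i = k} → X | ∀ i j, w i = w j} := by
    ext w
    have aux : ∀ j k (h : p j = k), w k ⟨j, h⟩ = w (p j) ⟨j, rfl⟩ := by rintro j _ rfl; rfl
    simp only [Set.mem_preimage, Set.mem_pi, Set.mem_univ, true_imp_iff, Subtype.forall,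
      Set.mem_ofPred_eq]
    constructor
    · intro hw k i hi j hj
      rw [aux i k hi, aux j k hj]
      exact hw i j (hi.trans hj.symm)
    · intro hw i j hij
      rw [hw (p i) i rfl j hij.symm, aux]
  have hc (k : κ) : Measurable fun (x : X) (_ : {i // p i = k}) => x :=
    measurable_pi_lambda _ fun _ => measurable_id
  have : ∀ k, SigmaFinite ((ν k).map fun x (_ : {i // p i = k}) => x) := fun k => by
    rw [← h k]; infer_instance
  rw [← Measure.map_pi_fiber p μ, Measure.restrict_map hm hD, hpre, Measure.restrict_pi_pi]
  simp_rw [h]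
  rw [← Measure.pi_map_pi fun k => (hc k).aemeasurable, Measure.map_map hm]
  · rfl
  · exact measurable_pi_lambda _ fun k => (hc k).comp (measurable_pi_apply k)

theorem Measure.pi_eq_map_const_of_subsingleton {X F : Type*} [MeasurableSpace X] [Fintype F]
    [Nonempty F] [Subsingleton F] (μ : F → Measure X) [∀ i, SigmaFinite (μ i)] {ν : Measure X}
    (h : ∀ i, μ i = ν) : Measure.pi μ = ν.map fun x _ => x := by
  refine Measure.pi_eq fun s hs => ?_
  have hc : Measurable fun (x : X) (_ : F) => x := measurable_pi_lambda _ fun _ => measurable_id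
  obtain ⟨i⟩ := ‹Nonempty F›
  have : Unique F := uniqueOfSubsingleton i
  rw [Measure.map_apply hc (MeasurableSet.univ_pi hs), Fintype.prod_unique, h]
  congr 1
  ext x
  simp [Unique.forall_iff]

/-- The set of vectors with two given coordinates equal is null as soon as one of the two
factors has no atoms. -/
theorem Measure.pi_setOf_apply_eq_apply {X ι : Type*} [TopologicalSpace X] [T2Space X]
    [SecondCountableTopology X] [MeasurableSpace X] [BorelSpace X] [Fintype ι]
    (μ : ι → Measure X) [∀ i, SigmaFinite (μ i)] {i j : ι} (hij : i ≠ j)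
    [NullSingletonClass (μ j)] : Measure.pi μ {x | x i = x j} = 0 := by
  classical
  have hs : MeasurableSet {x : ι → X | x i = x j} :=
    measurableSet_eq_fun (measurable_pi_apply i) (measurable_pi_apply j)
  have h : ∫⁻ x, {x : ι → X | x i = x j}.indicator 1 x ∂Measure.pi μ =
      ∫⁻ _, 0 ∂Measure.pi μ := by
    refine lintegral_eq_of_lmarginal_eq {j} (measurable_one.indicator hs) measurable_const ?_
    funext x
    rw [lmarginal_singleton, lmarginal_singleton, lintegral_zero]
    have : (fun t => {x : ι → X | x i = x j}.indicator (1 : (ι → X) → ℝ≥0∞)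
        (Function.update x j t)) = ({x i} : Set X).indicator 1 := by
      funext t
      simp [Set.indicator, hij, eq_comm]
    exact (congrArg (fun g => ∫⁻ t, g t ∂μ j) this).trans
      ((lintegral_indicator_one (measurableSet_singleton _)).trans (measure_singleton _))
  rwa [lintegral_indicator_one hs, lintegral_zero] at h

end MeasureTheory

namespace Configuration

/-- On the small diagonal, the product measure `ω ⊗ ⋯ ⊗ ω` is the image of `ω`, since it charges
each point `(x, …, x)` with `x ∈ ω` by one. -/
theorem restrict_pi_toMeasure {X : Type*} [TopologicalSpace X] [T2Space X]
    [SecondCountableTopology X] [SigmaCompactSpace X] [MeasurableSpace X] [BorelSpace X]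
    {F : Type*} [Fintype F] [Nonempty F] (ω : Configuration X) :
    (Measure.pi fun _ : F => ω.toMeasure).restrict {w | ∀ i j, w i = w j} =
      ω.toMeasure.map fun x _ => x := by
  have hc : Measurable fun (x : X) (_ : F) => x := measurable_pi_lambda _ fun _ => measurable_id
  have : Countable ω.carrier := ω.countable_carrier.to_subtype
  obtain ⟨i₀⟩ := ‹Nonempty F›
  have hae : ({w : F → X | ∀ i j, w i = w j} : Set (F → X)) =ᵐ[Measure.pi fun _ => ω.toMeasure]
      ⋃ x : ω.carrier, {fun _ => (x : X)} := by
    have h0 : ∀ᵐ w ∂(Measure.pi fun _ : F => ω.toMeasure), w i₀ ∈ ω.carrier := by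
      have h1 : ∀ᵐ x ∂ω.toMeasure, x ∈ ω.carrier := ω.toMeasure_compl_carrier
      exact (Measure.tendsto_eval_ae_ae (i := i₀)).eventually h1
    filter_upwards [h0] with w hw
    apply propext
    change (∀ i j, w i = w j) ↔ w ∈ ⋃ x : ω.carrier, {fun _ => (x : X)}
    simp only [Set.mem_iUnion, Set.mem_singleton_iff]
    constructor
    · exact fun h => ⟨⟨w i₀, hw⟩, funext fun i => h i i₀⟩
    · rintro ⟨x, rfl⟩ i j
      rfl
  rw [Measure.restrict_congr_set hae, Measure.restrict_iUnion]
  · conv_rhs => rw [toMeasure, Measure.map_sum hc.aemeasurable]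
    congr 1
    funext x
    rw [Measure.restrict_singleton, Measure.map_dirac' hc, Measure.pi_singleton]
    simp [toMeasure_singleton x.2]
  · intro x y hxy
    refine Set.disjoint_singleton.2 fun h => hxy (Subtype.ext ?_)
    exact congrFun h i₀
  · exact fun x => measurableSet_singleton _

end Configuration

/-! ### Splitting by coincidence patterns -/

namespace MeasureTheory

theorem Measure.map_pi_comp_equiv {X ι κ : Type*} [MeasurableSpace X] [Fintype ι] [Fintype κ]
    (e : κ ≃ ι) (μ : ι → Measure X) [∀ i, SigmaFinite (μ i)] :
    (Measure.pi fun k => μ (e k)).map (fun y i => y (e.symm i)) = Measure.pi μ := by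
  refine (Measure.pi_eq fun s hs => ?_).symm
  have hm : Measurable fun (y : κ → X) i => y (e.symm i) :=
    measurable_pi_lambda _ fun i => measurable_pi_apply _
  have hpre : (fun (y : κ → X) i => y (e.symm i)) ⁻¹' Set.univ.pi s =
      Set.univ.pi fun k => s (e k) := by
    ext y
    simp only [Set.mem_preimage, Set.mem_pi, Set.mem_univ, true_imp_iff]
    exact ⟨fun h k => by simpa using h (e k), fun h i => by simpa using h (e.symm i)⟩
  rw [Measure.map_apply hm (MeasurableSet.univ_pi hs), hpre, Measure.pi_pi]
  exact Equiv.prod_comp e fun i => μ i (s i)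

end MeasureTheory

section reindex

variable {X : Type u} [TopologicalSpace X] [T2Space X] [SecondCountableTopology X]
  [MeasurableSpace X] [BorelSpace X]

theorem setLIntegral_offDiagonal_comp_equiv {ι κ : Type*} [Fintype ι] [Fintype κ] (e : κ ≃ ι)
    (μ : ι → Measure X) [∀ i, SigmaFinite (μ i)] {G : (ι → X) → ℝ≥0∞} (hG : Measurable G) :
    ∫⁻ y in offDiagonal ι X, G y ∂Measure.pi μ =
      ∫⁻ z in offDiagonal κ X, G (fun i => z (e.symm i)) ∂(Measure.pi fun k => μ (e k)) := by
  have hm : Measurable fun (y : κ → X) i => y (e.symm i) :=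
    measurable_pi_lambda _ fun i => measurable_pi_apply _
  have hpre : (fun (y : κ → X) i => y (e.symm i)) ⁻¹' offDiagonal ι X = offDiagonal κ X := by
    ext y
    simp only [Set.mem_preimage, offDiagonal, Set.mem_ofPred_eq]
    exact ⟨fun h k l hkl => by simpa using h (e k) (e l) (e.injective.ne hkl),
      fun h i j hij => h _ _ (e.symm.injective.ne hij)⟩
  rw [← Measure.map_pi_comp_equiv e μ, setLIntegral_map (measurableSet_offDiagonal ι) hG hm, hpre]

variable [SigmaCompactSpace X] {ι : Type*} [Fintype ι]
  {g : (ι → X) → Configuration X → ℝ≥0∞}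

theorem measurable_setLIntegral_offDiagonal_mixedMeasure (σ : Measure X) [SigmaFinite σ]
    (ε : ι → Fin 2) (hg : Measurable fun p : (ι → X) × Configuration X => g p.1 p.2) :
    Measurable fun ω => ∫⁻ y in offDiagonal ι X, g y ω
      ∂(Measure.pi fun i => mixedMeasure σ ω (ε i)) := by
  have e := (Fintype.equivFin ι).symm
  have hm : Measurable fun p : Configuration X × (Fin (Fintype.card ι) → X) =>
      ((fun i => p.2 (e.symm i), p.1) : (ι → X) × Configuration X) :=
    (measurable_pi_lambda _ fun i => (measurable_pi_apply _).comp measurable_snd).prodMk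
      measurable_fst
  have hD := measurableSet_offDiagonal (X := X) (Fin (Fintype.card ι))
  have h (ω : Configuration X) := setLIntegral_offDiagonal_comp_equiv e
    (fun i => mixedMeasure σ ω (ε i)) (G := fun y => g y ω)
    (hg.comp (measurable_id.prodMk measurable_const))
  simp_rw [h, ← lintegral_indicator hD]
  refine measurable_lintegral_pi_mixedMeasure σ (fun k => ε (e k)) measurable_id ?_
  exact Measurable.indicator (s := {p : Configuration X × (Fin (Fintype.card ι) → X) |
    p.2 ∈ offDiagonal _ X}) (hg.comp hm) (hD.preimage measurable_snd)

/-- The multivariate Mecke formula with coordinates labelled by a finite type. -/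
theorem IsPoissonLaw.lintegral_offDiagonal_fintype {σ : Measure X} [SigmaFinite σ]
    [NullSingletonClass σ] {Pr : Measure (Configuration X)} (hPr : IsPoissonLaw σ Pr)
    (ε : ι → Fin 2) (hg : Measurable fun p : (ι → X) × Configuration X => g p.1 p.2) :
    ∫⁻ ω, ∫⁻ y in offDiagonal ι X, g y ω ∂(Measure.pi fun i => mixedMeasure σ ω (ε i)) ∂Pr =
      ∫⁻ y in offDiagonal ι X,
        ∫⁻ ω, g y (ω.unionFinite (y '' {i | ε i = 1}) ((Set.toFinite _).image y)) ∂Pr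
        ∂(Measure.pi fun _ => σ) := by
  have := hPr.isProbabilityMeasure
  have e := (Fintype.equivFin ι).symm
  have hm : Measurable fun p : (Fin (Fintype.card ι) → X) × Configuration X =>
      ((fun i => p.1 (e.symm i), p.2) : (ι → X) × Configuration X) :=
    (measurable_pi_lambda _ fun i => (measurable_pi_apply _).comp measurable_fst).prodMk
      measurable_snd
  have h (ω : Configuration X) := setLIntegral_offDiagonal_comp_equiv e
    (fun i => mixedMeasure σ ω (ε i)) (G := fun y => g y ω)
    (hg.comp (measurable_id.prodMk measurable_const))
  have hU : Measurable fun p : (ι → X) × Configuration X =>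
      g p.1 (p.2.unionFinite (p.1 '' {i | ε i = 1}) ((Set.toFinite _).image p.1)) :=
    hg.comp (measurable_fst.prodMk (Configuration.measurable_unionFinite_image _))
  simp_rw [h]
  rw [setLIntegral_offDiagonal_comp_equiv e (fun _ => σ) hU.lintegral_prod_right',
    hPr.lintegral_offDiagonal _ (fun k => ε (e k)) (g := fun z ω => g (fun i => z (e.symm i)) ω)
      (hg.comp hm)]
  refine lintegral_congr fun z => lintegral_congr fun ω => ?_
  have : z '' {k | ε (e k) = 1} = (fun i => z (e.symm i)) '' {i | ε i = 1} := by
    ext x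
    simp only [Set.mem_image, Set.mem_ofPred_eq]
    exact ⟨fun ⟨k, hk, hx⟩ => ⟨e k, hk, by simpa using hx⟩,
      fun ⟨i, hi, hx⟩ => ⟨e.symm i, by simpa using hi, hx⟩⟩
  simp only [this]

end reindex

namespace Finpartition

variable {n : ℕ} {X : Type*}

theorem blockOf_eq_iff (P : Finpartition (Finset.univ : Finset (Fin n))) (i j : Fin n) :
    P.blockOf i = P.blockOf j ↔ P.part i = P.part j := Subtype.ext_iff

theorem blockOf_eq_of_mem (P : Finpartition (Finset.univ : Finset (Fin n))) {i : Fin n}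
    {B : {B // B ∈ P.parts}} (h : i ∈ B.1) : P.blockOf i = B :=
  Subtype.ext (P.part_eq_of_mem B.2 h)

theorem mem_of_blockOf_eq (P : Finpartition (Finset.univ : Finset (Fin n))) {i : Fin n}
    {B : {B // B ∈ P.parts}} (h : P.blockOf i = B) : i ∈ B.1 := by
  rw [← h]
  exact P.mem_part_self.2 (Finset.mem_univ i)

theorem blockOf_surjective (P : Finpartition (Finset.univ : Finset (Fin n))) :
    Function.Surjective P.blockOf := fun B => by
  obtain ⟨i, hi⟩ := P.nonempty_of_mem_parts B.2
  exact ⟨i, P.blockOf_eq_of_mem hi⟩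

theorem eq_of_blockOf_eq_iff {P Q : Finpartition (Finset.univ : Finset (Fin n))}
    (h : ∀ i j, P.blockOf i = P.blockOf j ↔ Q.blockOf i = Q.blockOf j) : P = Q := by
  have hpart (i : Fin n) : P.part i = Q.part i := by
    ext j
    rw [P.mem_part_iff_part_eq_part (Finset.mem_univ _) (Finset.mem_univ _),
      Q.mem_part_iff_part_eq_part (Finset.mem_univ _) (Finset.mem_univ _),
      ← P.blockOf_eq_iff, ← Q.blockOf_eq_iff]
    exact h _ _
  ext B
  constructor
  · intro hB
    obtain ⟨i, hi⟩ := P.nonempty_of_mem_parts hB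
    rw [← P.part_eq_of_mem hB hi, hpart]
    exact Q.part_mem.2 (Finset.mem_univ i)
  · intro hB
    obtain ⟨i, hi⟩ := Q.nonempty_of_mem_parts hB
    rw [← Q.part_eq_of_mem hB hi, ← hpart]
    exact P.part_mem.2 (Finset.mem_univ i)

/-- The vectors whose coincidence pattern is `P`: two coordinates agree exactly if their indices
lie in the same block. -/
def stratum (P : Finpartition (Finset.univ : Finset (Fin n))) (X : Type*) : Set (Fin n → X) :=
  {x | ∀ i j, x i = x j ↔ P.blockOf i = P.blockOf j}

theorem pairwise_disjoint_stratum :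
    Pairwise (Function.onFun Disjoint
      fun P : Finpartition (Finset.univ : Finset (Fin n)) => P.stratum X) := by
  intro P Q hPQ
  refine Set.disjoint_left.2 fun x hP hQ => hPQ (eq_of_blockOf_eq_iff fun i j => ?_)
  rw [← hP i j, hQ i j]

theorem iUnion_stratum :
    ⋃ P : Finpartition (Finset.univ : Finset (Fin n)), P.stratum X = Set.univ := by
  classical
  refine Set.eq_univ_of_forall fun x => Set.mem_iUnion.2 ⟨ofSetoid (Setoid.ker x), fun i j => ?_⟩
  rw [blockOf_eq_iff, ← mem_part_iff_part_eq_part _ (Finset.mem_univ i) (Finset.mem_univ j),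
    mem_part_ofSetoid_iff_rel, Setoid.ker_def]
  exact eq_comm

theorem stratum_eq_inter (P : Finpartition (Finset.univ : Finset (Fin n))) :
    P.stratum X = {x | ∀ i j, P.blockOf i ≠ P.blockOf j → x i ≠ x j} ∩
      {x | ∀ i j, P.blockOf i = P.blockOf j → x i = x j} := by
  ext x
  simp only [stratum, Set.mem_inter_iff, Set.mem_ofPred_eq]
  exact ⟨fun h => ⟨fun i j hij hx => hij ((h i j).1 hx), fun i j => (h i j).2⟩,
    fun h i j => ⟨fun hx => not_imp_not.1 (h.1 i j) hx, h.2 i j⟩⟩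

theorem preimage_expand_setOf_ne (P : Finpartition (Finset.univ : Finset (Fin n))) :
    P.expand ⁻¹' {x : Fin n → X | ∀ i j, P.blockOf i ≠ P.blockOf j → x i ≠ x j} =
      offDiagonal {B // B ∈ P.parts} X := by
  ext y
  simp only [Set.mem_preimage, Set.mem_ofPred_eq, expand, offDiagonal]
  constructor
  · intro h B C hBC
    obtain ⟨i, rfl⟩ := P.blockOf_surjective B
    obtain ⟨j, rfl⟩ := P.blockOf_surjective C
    exact h i j hBC
  · exact fun h i j hij => h _ _ hij

theorem measurable_expand [MeasurableSpace X]
    (P : Finpartition (Finset.univ : Finset (Fin n))) :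
    Measurable (P.expand : ({B // B ∈ P.parts} → X) → Fin n → X) :=
  measurable_pi_lambda _ fun _ => measurable_pi_apply _

variable [TopologicalSpace X] [T2Space X] [SecondCountableTopology X] [MeasurableSpace X]
  [BorelSpace X]

theorem measurableSet_setOf_blockOf_ne (P : Finpartition (Finset.univ : Finset (Fin n))) :
    MeasurableSet {x : Fin n → X | ∀ i j, P.blockOf i ≠ P.blockOf j → x i ≠ x j} := by
  simp only [Set.ofPred_forall]
  exact MeasurableSet.iInter fun i => MeasurableSet.iInter fun j => MeasurableSet.iInter fun _ =>
    (measurableSet_eq_fun (measurable_pi_apply i) (measurable_pi_apply j)).compl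

theorem measurableSet_setOf_blockOf_eq (P : Finpartition (Finset.univ : Finset (Fin n))) :
    MeasurableSet {x : Fin n → X | ∀ i j, P.blockOf i = P.blockOf j → x i = x j} := by
  simp only [Set.ofPred_forall]
  exact MeasurableSet.iInter fun i => MeasurableSet.iInter fun j => MeasurableSet.iInter fun _ =>
    measurableSet_eq_fun (measurable_pi_apply i) (measurable_pi_apply j)

theorem measurableSet_stratum (P : Finpartition (Finset.univ : Finset (Fin n))) :
    MeasurableSet (P.stratum X) := by
  rw [stratum_eq_inter]
  exact P.measurableSet_setOf_blockOf_ne.inter P.measurableSet_setOf_blockOf_eq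

/-- If `P` is not admissible then some block contains two indices, one of which is integrated
against the non-atomic measure `σ`. -/
theorem pi_mixedMeasure_stratum_of_notMem [SigmaCompactSpace X] (σ : Measure X) [SigmaFinite σ]
    [NullSingletonClass σ] (ω : Configuration X) {ε : Fin n → Fin 2}
    {P : Finpartition (Finset.univ : Finset (Fin n))} (hP : P ∉ admissiblePartitions ε) :
    (Measure.pi fun i => mixedMeasure σ ω (ε i)) (P.stratum X) = 0 := by
  simp only [admissiblePartitions, Finset.mem_filter, Finset.mem_univ, true_and, not_forall] at hP
  obtain ⟨B, hB, hcard, j, hj, hε⟩ := hP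
  obtain ⟨i, hi, hij⟩ := Finset.exists_mem_ne hcard j
  have : NullSingletonClass (mixedMeasure σ ω (ε j)) := by
    simp only [mixedMeasure, hε, if_false]
    infer_instance
  refine measure_mono_null (fun x hx => ?_)
    (Measure.pi_setOf_apply_eq_apply (fun i => mixedMeasure σ ω (ε i)) hij)
  exact (hx i j).2 ((P.blockOf_eq_of_mem (B := ⟨B, hB⟩) hi).trans
    (P.blockOf_eq_of_mem (B := ⟨B, hB⟩) hj).symm)

/-- For admissible `P`, the part of `⊗ ω_{ε i}` on the vectors that are constant on the blocks
is the image of the product over the blocks: a block of several indices carries copies of `ω`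
only, which merge into one. -/
theorem restrict_pi_mixedMeasure [SigmaCompactSpace X] (σ : Measure X) [SigmaFinite σ]
    (ω : Configuration X) {ε : Fin n → Fin 2}
    {P : Finpartition (Finset.univ : Finset (Fin n))} (hP : P ∈ admissiblePartitions ε) :
    (Measure.pi fun i => mixedMeasure σ ω (ε i)).restrict
        {x | ∀ i j, P.blockOf i = P.blockOf j → x i = x j} =
      (Measure.pi fun B => mixedMeasure σ ω (P.blockSign ε B)).map P.expand := by
  refine Measure.restrict_pi_const_on_fibers P.blockOf _ _ P.measurableSet_setOf_blockOf_eq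
    fun B => ?_
  have hsign (i : {i // P.blockOf i = B}) : ε i = P.blockSign ε B :=
    (P.blockSign_eq ε hP B i (P.mem_of_blockOf_eq i.2)).symm
  obtain ⟨i₀, hi₀⟩ := P.blockOf_surjective B
  have : Nonempty {i // P.blockOf i = B} := ⟨⟨i₀, hi₀⟩⟩
  simp_rw [hsign]
  by_cases h : P.blockSign ε B = 1
  · simp only [mixedMeasure, h, if_true]
    exact ω.restrict_pi_toMeasure
  · have hcard : B.1.card ≤ 1 := by
      by_contra! hlt
      have := (Finset.mem_filter.1 hP).2 B.1 B.2 hlt i₀ (P.mem_of_blockOf_eq hi₀)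
      exact h (hsign ⟨i₀, hi₀⟩ ▸ this)
    have : Subsingleton {i // P.blockOf i = B} := ⟨fun i j => Subtype.ext
      (Finset.card_le_one.1 hcard _ (P.mem_of_blockOf_eq i.2) _ (P.mem_of_blockOf_eq j.2))⟩
    have huniv : {w : {i // P.blockOf i = B} → X | ∀ i j, w i = w j} = Set.univ :=
      Set.eq_univ_of_forall fun w i j => congrArg w (Subsingleton.elim i j)
    rw [huniv, Measure.restrict_univ]
    exact Measure.pi_eq_map_const_of_subsingleton _ fun _ => rfl

end Finpartition

/-- The integral against `⊗ ω_{ε i}` split according to the coincidence pattern of the vector of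
integration variables. -/
theorem lintegral_pi_mixedMeasure_eq_sum {X : Type*} [TopologicalSpace X] [T2Space X]
    [SecondCountableTopology X] [SigmaCompactSpace X] [MeasurableSpace X] [BorelSpace X]
    (σ : Measure X) [SigmaFinite σ] [NullSingletonClass σ] (ω : Configuration X) {n : ℕ}
    (ε : Fin n → Fin 2) {f : (Fin n → X) → ℝ≥0∞} (hf : Measurable f) :
    ∫⁻ x, f x ∂(Measure.pi fun i => mixedMeasure σ ω (ε i)) =
      ∑ P ∈ admissiblePartitions ε, ∫⁻ y in offDiagonal {B // B ∈ P.parts} X, f (P.expand y)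
        ∂(Measure.pi fun B => mixedMeasure σ ω (P.blockSign ε B)) := by
  classical
  rw [← setLIntegral_univ, ← Finpartition.iUnion_stratum,
    lintegral_iUnion (fun P => P.measurableSet_stratum) Finpartition.pairwise_disjoint_stratum,
    tsum_fintype, ← Finset.sum_subset (Finset.subset_univ (admissiblePartitions ε))]
  · refine Finset.sum_congr rfl fun P hP => ?_
    rw [P.stratum_eq_inter, ← Measure.restrict_restrict P.measurableSet_setOf_blockOf_ne,
      P.restrict_pi_mixedMeasure σ ω hP,
      setLIntegral_map P.measurableSet_setOf_blockOf_ne hf P.measurable_expand,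
      P.preimage_expand_setOf_ne]
  · intro P _ hP
    exact setLIntegral_measure_zero _ _ (P.pi_mixedMeasure_stratum_of_notMem σ ω hP)

theorem mainTheorem1 {X : Type*} [MetricSpace X] [LocallyCompactSpace X]
    [TopologicalSpace.SeparableSpace X] [MeasurableSpace X] [BorelSpace X]
    (σ : Measure X) [SigmaFinite σ] [NullSingletonClass σ]
    (Pr : Measure (Configuration X)) (hPr : IsPoissonLaw σ Pr)
    (n : ℕ) (f : (Fin n → X) → Configuration X → ℝ≥0∞)
    (hf : Measurable fun p : (Fin n → X) × Configuration X => f p.1 p.2)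
    (ε : Fin n → Fin 2) :
    ∫⁻ ω, ∫⁻ x, f x ω ∂(Measure.pi fun i => mixedMeasure σ ω (ε i)) ∂Pr =
      ∑ P ∈ admissiblePartitions ε,
        ∫⁻ y in offDiagonal {B // B ∈ P.parts} X,
          ∫⁻ ω, f (P.expand y) (ω.unionFinite (P.markedPoints ε y) (P.markedPoints_finite ε y)) ∂Pr
          ∂(Measure.pi fun _ => σ) := by
  have : SecondCountableTopology X := UniformSpace.secondCountable_of_separable X
  have hP (P : Finpartition (Finset.univ : Finset (Fin n))) :
      Measurable fun p : ({B // B ∈ P.parts} → X) × Configuration X => f (P.expand p.1) p.2 :=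
    hf.comp ((P.measurable_expand.comp measurable_fst).prodMk measurable_snd)
  calc _ = ∫⁻ ω, ∑ P ∈ admissiblePartitions ε,
        ∫⁻ y in offDiagonal {B // B ∈ P.parts} X, f (P.expand y) ω
          ∂(Measure.pi fun B => mixedMeasure σ ω (P.blockSign ε B)) ∂Pr :=
        lintegral_congr fun ω => lintegral_pi_mixedMeasure_eq_sum σ ω ε
          (hf.comp (measurable_id.prodMk measurable_const))
    _ = ∑ P ∈ admissiblePartitions ε, ∫⁻ ω,
        ∫⁻ y in offDiagonal {B // B ∈ P.parts} X, f (P.expand y) ω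
          ∂(Measure.pi fun B => mixedMeasure σ ω (P.blockSign ε B)) ∂Pr :=
        lintegral_finsetSum _ fun P _ =>
          measurable_setLIntegral_offDiagonal_mixedMeasure σ _ (hP P)
    _ = _ := Finset.sum_congr rfl fun P _ =>
        hPr.lintegral_offDiagonal_fintype (P.blockSign ε) (hP P)
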